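/- Let $n\ge 0$. Let $\mathcal C_{\{-1,0,1\}}(n)$ be the type $C$ Catalan arrangement in $\mathbb R^n$, i.e. the set of hyperplanes $x_i-x_j=s$, $x_i+x_j=s$ ($1\le i<j\le n$) and $2x_i=s$ ($1\le i\le n$), with $s\in\{-1,0,1\}$; its regions are the connected components of the complement of the union of these hyperplanes. Write $L_n=\{-n,\dots,n\}\setminus\{0\}$ and $x_{-i}=-x_i$. **Sketches.** A symmetric annotated $1$-sketch of size $2n$ is a word $w=w_1\cdots w_{4n}$ such that for all $i,j\in L_n$: (i) $\{w_1,\dots,w_{4n}\}=\{\alpha_i^{(s)} : i\in L_n,\ s\in\{0,1\}\}$; (ii) $\alpha_i^{(0)}$ appears before $\alpha_i^{(1)}$; (iii) if $\alpha_i^{(0)}$ appears before $\alpha_j^{(0)}$, then $\alpha_i^{(1)}$ appears before $\alpha_j^{(1)}$; (iv) for $s\in\{0,1\}$, if $\alpha_i^{(0)}$ appears before $\alpha_j^{(s)}$, then $\alpha_{-j}^{(0)}$ appears before $\alpha_{-i}^{(s)}$. Let $D^{(1)}(2n)$ be the set of these words. **Symmetric forests.** In a rooted ordered forest whose nodes carry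 distinct integer labels, $i$ is a sub-descendant of $j$ if, in breadth-first order, $i$ appears after $j$ and strictly before every child of $j$ and every child of a node that follows $j$. A symmetric forest with $2n$ nodes is a rooted labeled ordered forest whose labels, read in breadth-first order, are $e_1,\dots,e_{2n}$, such that (i) $\{|e_1|,\dots,|e_n|\}=\{1,\dots,n\}$; (ii) $e_{n+j}=-e_{n-j+1}$ for $1\le j\le n$; (iii) for all nodes $i,j$, if $i$ is a sub-descendant of $j$, then $-j$ is a sub-descendant of $-i$. Let $F_S(2n)$ be the set of these forests. **The maps.** For a point $x$ of the complement of the arrangement, the $4n$ numbers $x_i+s$ ($i\in L_n$, $s\in\{0,1\}$) are distinct, and $\sigma(x)$ is the word that lists the letters $\alpha_i^{(s)}$ in increasing order of $x_i+s$. For $w\in D^{(1)}(2n)$, the forest $\phi(w)$ is built by reading $w$ from left to right: when $\alpha_i^{(0)}$ is read, a node $i$ is created; if it is the first letter, $i$ is a root; if the preceding letter is $\alpha_j^{(0)}$, then $i$ becomes the next right sibling of $j$; if the preceding letter is $\alpha_j^{(1)}$, then $i$ becomes the leftmost child of $j$. **Statement.** The word $\sigma(x)$ depends only on the region containing $x$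 and lies in $D^{(1)}(2n)$, so that $\sigma$ is a map from the regions of $\mathcal C_{\{-1,0,1\}}(n)$ to $D^{(1)}(2n)$; the forest $\phi(w)$ lies in $F_S(2n)$ for every $w\in D^{(1)}(2n)$; and the composite $\Phi=\phi\circ\sigma$ is a bijection from the set of regions of $\mathcal C_{\{-1,0,1\}}(n)$ to the set $F_S(2n)$ of symmetric forests with $2n$ nodes. -/

import Mathlib

namespace TypeCCatalan

/-- The hyperplanes `x_i - x_j = s`, `x_i + x_j = s` (for `i < j`) and `2 x_i = s` of `ℝⁿ`,
where `s ∈ {-1, 0, 1}`. -/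
def arrangement (n : ℕ) : Set (Set (Fin n → ℝ)) :=
  {H | ∃ s ∈ ({-1, 0, 1} : Set ℝ),
    (∃ i j : Fin n, i < j ∧ (H = {x | x i - x j = s} ∨ H = {x | x i + x j = s})) ∨
    (∃ i : Fin n, H = {x | 2 * x i = s})}

/-- The complement of the union of the hyperplanes. -/
def complement (n : ℕ) : Set (Fin n → ℝ) := (⋃₀ arrangement n)ᶜ

/-- The regions: the connected components of the complement. -/
def regions (n : ℕ) : Set (Set (Fin n → ℝ)) :=
  {R | ∃ x ∈ complement n, R = connectedComponentIn (complement n) x}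

/-- The set of nonzero integers between `-n` and `n`. -/
noncomputable def labels (n : ℕ) : Finset ℤ := (Finset.Icc (-(n : ℤ)) n).erase 0

/-- The pair `(i, s)` is the letter `α_i^{(s)}`. -/
abbrev Letter : Type := ℤ × Fin 2

/-- The alphabet of the letters `α_i^{(0)}`, `α_i^{(1)}`, for `i ∈ labels n`. -/
noncomputable def alphabet (n : ℕ) : Finset Letter := labels n ×ˢ Finset.univ

/-- In the list `l`, some occurrence of `a` is before some occurrence of `b`. -/
def Precedes {α : Type} (l : List α) (a b : α) : Prop := List.Sublist [a, b] l

/-- The symmetric annotated 1-sketches of size `2n`. -/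
structure IsSymmetricSketch (n : ℕ) (w : List Letter) : Prop where
  length_eq : w.length = 4 * n
  letters_eq : w.toFinset = alphabet n
  zero_before_one : ∀ i ∈ labels n, Precedes w (i, 0) (i, 1)
  same_order : ∀ i ∈ labels n, ∀ j ∈ labels n,
    Precedes w (i, 0) (j, 0) → Precedes w (i, 1) (j, 1)
  symmetric : ∀ i ∈ labels n, ∀ j ∈ labels n, ∀ s : Fin 2,
    Precedes w (i, 0) (j, s) → Precedes w (-j, 0) (-i, s)

/-- The set `D^{(1)}(2n)` of symmetric annotated 1-sketches of size `2n`. -/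
def sketches (n : ℕ) : Set (List Letter) := {w | IsSymmetricSketch n w}

/-- The coordinates `x_i` for `i ∈ labels n`, with `x_{-i} = -x_i`. -/
def coord {n : ℕ} (x : Fin n → ℝ) (i : ℤ) : ℝ :=
  if h : 1 ≤ i ∧ i ≤ n then x ⟨(i - 1).toNat, by omega⟩
  else if h : 1 ≤ -i ∧ -i ≤ n then -x ⟨(-i - 1).toNat, by omega⟩
  else 0

/-- The value `x_i + s` of the letter `α_i^{(s)}`. -/
def value {n : ℕ} (x : Fin n → ℝ) (a : Letter) : ℝ := coord x a.1 + ((a.2 : ℕ) : ℝ)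

/-- The word `σ(x)`: all letters of the alphabet in increasing order of their values. -/
noncomputable def sketchWord {n : ℕ} (x : Fin n → ℝ) : List Letter :=
  (alphabet n).toList.mergeSort (fun a b => decide (value x a ≤ value x b))

/-- Rooted labeled ordered forests: a forest is empty, or consists of a first tree, given by the
label of its root and the forest of the subtrees hanging from that root, followed by the
(ordered) forest of the other trees. -/
inductive Forest (α : Type) : Type
  | nil : Forest α
  | cons (root : α) (subtrees : Forest α) (rest : Forest α) : Forest α

namespace Forest

variable {α : Type}

/-- The number of nodes. -/
def size : Forest α → ℕ
  | nil => 0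
  | cons _ c r => 1 + c.size + r.size

/-- The labels of the nodes of depth `k`, from left to right; depth `0` gives the roots. -/
def level : Forest α → ℕ → List α
  | nil, _ => []
  | cons a _ r, 0 => a :: r.level 0
  | cons _ c r, k + 1 => c.level k ++ r.level (k + 1)

/-- The labels of all nodes in breadth-first order. -/
def bfs (F : Forest α) : List α := (List.range F.size).flatMap F.level

/-- `F.IsChild q p`: a node labeled `q` is a child of a node labeled `p`. -/
def IsChild : Forest α → α → α → Prop
  | nil, _, _ => False
  | cons a c r, q, p => (p = a ∧ q ∈ c.level 0) ∨ c.IsChild q p ∨ r.IsChild q p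

/-- `F.IsSubDescendant i j`: in breadth-first order, `i` is after `j` and strictly before any
child of `j` or of a node after `j`. (If `j` has a child, the first child of `j` is before all
children of the nodes after `j`.) -/
def IsSubDescendant (F : Forest α) (i j : α) : Prop :=
  Precedes F.bfs j i ∧
    ∀ k c, (k = j ∨ Precedes F.bfs j k) → F.IsChild c k → Precedes F.bfs i c

/-- Insert a new leaf `i` as the next right sibling of `j`. -/
def insertSibling [DecidableEq α] (j i : α) : Forest α → Forest α
  | nil => nil
  | cons a c r =>
    if a = j then cons a c (cons i nil r)
    else cons a (c.insertSibling j i) (r.insertSibling j i)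

/-- Insert a new leaf `i` as the leftmost child of `j`. -/
def insertChild [DecidableEq α] (j i : α) : Forest α → Forest α
  | nil => nil
  | cons a c r =>
    if a = j then cons a (cons i nil c) r
    else cons a (c.insertChild j i) (r.insertChild j i)

end Forest

/-- The symmetric forests with `2n` nodes. -/
structure IsSymmetricForest (n : ℕ) (F : Forest ℤ) : Prop where
  size_eq : F.size = 2 * n
  first_half : ((F.bfs.take n).map (fun e => |e|)).toFinset = Finset.Icc 1 (n : ℤ)
  last_half : F.bfs.drop n = ((F.bfs.take n).map (fun e => -e)).reverse
  subDescendant : ∀ i ∈ F.bfs, ∀ j ∈ F.bfs,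
    F.IsSubDescendant i j → F.IsSubDescendant (-j) (-i)

/-- The set `F_S(2n)` of symmetric forests with `2n` nodes. -/
def symmetricForests (n : ℕ) : Set (Forest ℤ) := {F | IsSymmetricForest n F}

/-- Read the rest of a word from left to right, `prev` being the letter read last (if any) and
`F` the forest built so far. -/
def readWord : (prev : Option Letter) → (F : Forest ℤ) → List Letter → Forest ℤ
  | _, F, [] => F
  | _, F, (i, 1) :: w => readWord (some (i, 1)) F w
  | none, _, (i, 0) :: w => readWord (some (i, 0)) (.cons i .nil .nil) w
  | some (j, 0), F, (i, 0) :: w => readWord (some (i, 0)) (F.insertSibling j i) w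
  | some (j, 1), F, (i, 0) :: w => readWord (some (i, 0)) (F.insertChild j i) w

/-- The forest `φ(w)`. -/
def forestOfWord (w : List Letter) : Forest ℤ := readWord none .nil w

end TypeCCatalan

namespace TypeCCatalan

/-! ### Order of occurrence in a list. -/

section Precedes

variable {α : Type} {l A C : List α} {a b c : α}

/-! Both factors of the composite are bijections.

Regions and sketches: with `x_{-i} = -x_i`, a point avoids the arrangement exactly when its letter
values are distinct (`mem_complement_iff`). By the intermediate value theorem the order of the
values is constant on a region, and two points with the same order are joined by a segment in the
complement. Every sketch occurs: values `y_i` realizing the word are chosen greedily, then `y` is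
averaged with the solution `-y_{-i}` to make it antisymmetric (`exists_sketchWord_eq`).

Sketches and forests: cut a word before each letter `α_v^{(1)}`. The initial piece lists the roots
`R`, and the letters after `α_v^{(1)}` list the children `f v`. Conditions (ii) and (iii) say that
the order `L` of the superscript 1 letters satisfies `L = R ++ L.flatMap f` and that each node is
created before its block is read; these properties characterize breadth-first order (`IsBfsOrder`).
Then `φ` builds the forest with roots `R`, children `f` and breadth-first order `L`
(`forestOfWord_spec`), and these data determine the word.

In (iv), the case `s = 0` makes `L` invariant under reversal with negation. For `s = 1` the link is
`isSubDescendant_iff`: `i` is a sub-descendant of `j` when `j` is before `i` in `L` and `α_i^{(0)}`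
is before `α_j^{(1)}`. -/

theorem Precedes.mem_left (h : Precedes l a b) : a ∈ l := h.subset (by simp)

theorem Precedes.mem_right (h : Precedes l a b) : b ∈ l := h.subset (by simp)

theorem precedes_append_cons_iff (h : (A ++ b :: C).Nodup) :
    Precedes (A ++ b :: C) a b ↔ a ∈ A := by
  constructor
  · intro hp
    obtain ⟨l₁, l₂, he, h₁, h₂⟩ := List.sublist_append_iff.1 hp
    cases l₁ with
    | nil =>
      simp only [List.nil_append] at he
      subst he
      have h3 : b ∈ C := by
        have := List.Sublist.tail h₂
        simpa using this
      simp [List.nodup_append, h3] at h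
    | cons d l₁ =>
      simp only [List.cons_append, List.cons.injEq] at he
      exact he.1 ▸ h₁.subset (by simp)
  · intro ha
    exact (List.singleton_sublist.2 ha).append (List.singleton_sublist.2 (by simp))

theorem precedes_iff_idxOf [DecidableEq α] (h : l.Nodup) :
    Precedes l a b ↔ b ∈ l ∧ l.idxOf a < l.idxOf b := by
  by_cases hb : b ∈ l
  · obtain ⟨A, C, rfl⟩ := List.append_of_mem hb
    have hbA : b ∉ A := by
      intro hbA
      simp [List.nodup_append] at h
      exact (h.2.2 b hbA).1 rfl
    rw [precedes_append_cons_iff h]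
    simp only [hb, true_and, List.idxOf_append, hbA, if_false, List.idxOf_cons_self]
    split_ifs with ha
    · simp [ha, List.idxOf_lt_length_iff]
    · simp [ha]
  · simp only [hb, false_and, iff_false]
    exact fun hp => hb hp.mem_right

theorem Precedes.trans [DecidableEq α] (h : l.Nodup) (hab : Precedes l a b)
    (hbc : Precedes l b c) : Precedes l a c := by
  rw [precedes_iff_idxOf h] at *
  exact ⟨hbc.1, by omega⟩

theorem Precedes.asymm [DecidableEq α] (h : l.Nodup) (hab : Precedes l a b) :
    ¬ Precedes l b a := by
  rw [precedes_iff_idxOf h] at *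
  omega

theorem Precedes.ne [DecidableEq α] (h : l.Nodup) (hab : Precedes l a b) : a ≠ b := by
  rintro rfl
  exact hab.asymm h hab

theorem precedes_or_precedes [DecidableEq α] (h : l.Nodup) (ha : a ∈ l) (hb : b ∈ l)
    (hab : a ≠ b) : Precedes l a b ∨ Precedes l b a := by
  simp only [precedes_iff_idxOf h, ha, hb, true_and]
  have : l.idxOf a ≠ l.idxOf b := fun he => hab ((List.idxOf_inj ha).1 he)
  omega

/-- Both lists are sorted for the irreflexive antisymmetric relation `Precedes l'`, and such a list
is determined by its members. -/
theorem eq_of_precedes_imp [DecidableEq α] {l' : List α} (h' : l'.Nodup)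
    (hm : ∀ a, a ∈ l ↔ a ∈ l') (hp : ∀ a b, Precedes l a b → Precedes l' a b) : l = l' := by
  have : Std.Irrefl (Precedes l') := ⟨fun a ha => ha.ne h' rfl⟩
  have : Std.Antisymm (Precedes l') := ⟨fun a b hab hba => (hab.asymm h' hba).elim⟩
  exact List.Pairwise.eq_of_mem_iff (r := Precedes l')
    (List.pairwise_iff_forall_sublist.2 fun {a b} => hp a b)
    (List.pairwise_iff_forall_sublist.2 fun {a b} hab => hab) hm

theorem precedes_filter_iff {p : α → Bool} (ha : p a = true) (hb : p b = true) :
    Precedes (l.filter p) a b ↔ Precedes l a b := by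
  refine ⟨fun h => List.Sublist.trans h List.filter_sublist, fun h => ?_⟩
  have := List.Sublist.filter p h
  simpa [Precedes, ha, hb] using this

theorem precedes_map_iff {β : Type} {f : α → β} (hf : Function.Injective f) :
    Precedes (l.map f) (f a) (f b) ↔ Precedes l a b := by
  refine ⟨fun h => ?_, fun h => List.Sublist.map f h⟩
  obtain ⟨l', hl', he⟩ := List.sublist_map_iff.1 h
  have : [a, b].map f = l'.map f := by simpa using he
  have := hf.list_map this
  subst this
  exact hl'

theorem precedes_reverse_iff : Precedes l.reverse a b ↔ Precedes l b a := by
  unfold Precedes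
  rw [← List.reverse_sublist]
  simp

end Precedes

/-! ### Labels and letters. -/

section Alphabet

variable {n : ℕ}

theorem mem_labels {i : ℤ} : i ∈ labels n ↔ i ≠ 0 ∧ -(n : ℤ) ≤ i ∧ i ≤ n := by
  simp [labels]

theorem neg_mem_labels {i : ℤ} (h : i ∈ labels n) : -i ∈ labels n := by
  rw [mem_labels] at *
  omega

theorem mem_alphabet {a : Letter} : a ∈ alphabet n ↔ a.1 ∈ labels n := by
  simp [alphabet]

theorem card_labels : (labels n).card = 2 * n := by
  rw [labels, Finset.card_erase_of_mem (by simp)]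
  simp
  omega

theorem card_alphabet : (alphabet n).card = 4 * n := by
  rw [alphabet, Finset.card_product, card_labels]
  simp
  omega

theorem IsSymmetricSketch.nodup {w : List Letter} (h : IsSymmetricSketch n w) : w.Nodup := by
  rw [← Multiset.coe_nodup, ← Multiset.toFinset_card_eq_card_iff_nodup]
  change w.toFinset.card = w.length
  rw [h.letters_eq, card_alphabet, h.length_eq]

theorem IsSymmetricSketch.mem_iff {w : List Letter} (h : IsSymmetricSketch n w) (a : Letter) :
    a ∈ w ↔ a.1 ∈ labels n := by
  rw [← List.mem_toFinset, h.letters_eq, mem_alphabet]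

end Alphabet

/-! ### Signed coordinates. -/

section Coordinates

variable {n : ℕ} (x : Fin n → ℝ)

theorem coord_of_fin (k : Fin n) : coord x ((k : ℤ) + 1) = x k := by
  have : 1 ≤ (k : ℤ) + 1 ∧ (k : ℤ) + 1 ≤ n := by omega
  rw [coord, dif_pos this]
  congr
  simp

theorem coord_neg (i : ℤ) : coord x (-i) = -coord x i := by
  unfold coord
  by_cases h1 : 1 ≤ i ∧ i ≤ n
  · have h2 : ¬ (1 ≤ -i ∧ -i ≤ n) := by omega
    have h3 : 1 ≤ - -i ∧ - -i ≤ n := by omega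
    rw [dif_pos h1, dif_neg h2, dif_pos h3]
    simp
  · by_cases h2 : 1 ≤ -i ∧ -i ≤ n
    · rw [dif_pos h2, dif_neg h1, dif_pos h2]
      simp
    · have h3 : ¬ (1 ≤ - -i ∧ - -i ≤ n) := by omega
      rw [dif_neg h2, dif_neg h1, dif_neg h2, dif_neg h3]
      simp

theorem exists_fin_of_mem_labels {i : ℤ} (h : i ∈ labels n) :
    ∃ k : Fin n, i = (k : ℤ) + 1 ∨ i = -((k : ℤ) + 1) := by
  rw [mem_labels] at h
  refine ⟨⟨i.natAbs - 1, by omega⟩, ?_⟩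
  simp only
  omega

theorem fin_mem_labels (k : Fin n) : (k : ℤ) + 1 ∈ labels n := by
  rw [mem_labels]
  omega

theorem continuous_coord (i : ℤ) : Continuous fun x : Fin n → ℝ => coord x i := by
  unfold coord
  split_ifs <;> fun_prop

theorem coord_lineMap (y : Fin n → ℝ) (t : ℝ) (i : ℤ) :
    coord (AffineMap.lineMap x y t) i = AffineMap.lineMap (coord x i) (coord y i) t := by
  unfold coord
  split_ifs <;> simp [AffineMap.lineMap_apply]
  ring

end Coordinates

/-! ### The complement in terms of letter values. -/

section Complement

variable {n : ℕ} {x : Fin n → ℝ}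

/-- Signed labels merge the three families: `x_i + x_j = x_i - x_{-j}` and `2 x_i = x_i - x_{-i}`.
-/
theorem mem_complement_iff_forall_coord :
    x ∈ complement n ↔ ∀ i ∈ labels n, ∀ j ∈ labels n, i ≠ j →
      ∀ s ∈ ({-1, 0, 1} : Set ℝ), coord x i - coord x j ≠ s := by
  constructor
  · intro hx i hi j hj hij s hs he
    apply hx
    have hs' : -s ∈ ({-1, 0, 1} : Set ℝ) := by
      rcases hs with rfl | rfl | rfl <;> simp
    have key1 : ∀ k m : Fin n, ∀ r ∈ ({-1, 0, 1} : Set ℝ), -r ∈ ({-1, 0, 1} : Set ℝ) → k ≠ m →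
        x k - x m = r → x ∈ ⋃₀ arrangement n := by
      intro k m r hr hr' hkm h
      rcases lt_or_gt_of_ne hkm with hlt | hlt
      · exact ⟨{x | x k - x m = r}, ⟨r, hr, Or.inl ⟨k, m, hlt, Or.inl rfl⟩⟩, h⟩
      · exact ⟨{x | x m - x k = -r}, ⟨-r, hr', Or.inl ⟨m, k, hlt, Or.inl rfl⟩⟩, by
          simp only [Set.mem_ofPred_eq]; linarith⟩
    have key2 : ∀ k m : Fin n, ∀ r ∈ ({-1, 0, 1} : Set ℝ), x k + x m = r →
        x ∈ ⋃₀ arrangement n := by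
      intro k m r hr h
      rcases lt_trichotomy k m with hlt | rfl | hlt
      · exact ⟨{x | x k + x m = r}, ⟨r, hr, Or.inl ⟨k, m, hlt, Or.inr rfl⟩⟩, h⟩
      · exact ⟨{x | 2 * x k = r}, ⟨r, hr, Or.inr ⟨k, rfl⟩⟩, by
          simp only [Set.mem_ofPred_eq]; linarith⟩
      · exact ⟨{x | x m + x k = r}, ⟨r, hr, Or.inl ⟨m, k, hlt, Or.inr rfl⟩⟩, by
          simp only [Set.mem_ofPred_eq]; linarith⟩
    obtain ⟨k, rfl | rfl⟩ := exists_fin_of_mem_labels hi <;>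
    obtain ⟨m, rfl | rfl⟩ := exists_fin_of_mem_labels hj <;>
    simp only [coord_neg, coord_of_fin] at he
    · exact key1 k m s hs hs' (by rintro rfl; exact hij rfl) he
    · exact key2 k m s hs (by linarith)
    · exact key2 k m (-s) hs' (by linarith)
    · exact key1 k m (-s) hs' (by simpa using hs) (by rintro rfl; exact hij rfl) (by linarith)
  · rintro h ⟨H, ⟨s, hs, ⟨k, m, hkm, rfl | rfl⟩ | ⟨k, rfl⟩⟩, hx⟩ <;>
      simp only [Set.mem_ofPred_eq] at hx
    · refine h _ (fin_mem_labels k) _ (fin_mem_labels m) ?_ s hs ?_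
      · have := Fin.lt_def.1 hkm
        omega
      · rw [coord_of_fin, coord_of_fin, hx]
    · refine h _ (fin_mem_labels k) _ (neg_mem_labels (fin_mem_labels m)) (by omega) s hs ?_
      rw [coord_neg, coord_of_fin, coord_of_fin, sub_neg_eq_add, hx]
    · refine h _ (fin_mem_labels k) _ (neg_mem_labels (fin_mem_labels k)) (by omega) s hs ?_
      rw [coord_neg, coord_of_fin, sub_neg_eq_add, ← two_mul, hx]

/-- The values `-1, 0, 1` are exactly the differences of two superscripts. -/
theorem mem_complement_iff :
    x ∈ complement n ↔ ∀ a ∈ alphabet n, ∀ b ∈ alphabet n, value x a = value x b → a = b := by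
  rw [mem_complement_iff_forall_coord]
  constructor
  · rintro h ⟨i, s⟩ ha ⟨j, t⟩ hb he
    rw [mem_alphabet] at ha hb
    by_cases hij : i = j
    · subst hij
      simp only [value, add_right_inj, Nat.cast_inj] at he
      rw [Fin.ext he]
    · refine (h i ha j hb hij (((t : ℕ) : ℝ) - ((s : ℕ) : ℝ)) ?_ ?_).elim
      · fin_cases s <;> fin_cases t <;> simp
      · simp only [value] at he
        linarith
  · intro h i hi j hj hij s hs he
    have key : ∀ s t : Fin 2, coord x i + ((s : ℕ) : ℝ) = coord x j + ((t : ℕ) : ℝ) → False := by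
      intro s t hst
      exact hij (congrArg Prod.fst
        (h (i, s) (mem_alphabet.2 hi) (j, t) (mem_alphabet.2 hj) hst))
    rcases hs with rfl | rfl | rfl
    · exact key 1 0 (by simp; linarith)
    · exact key 0 0 (by simp; linarith)
    · exact key 0 1 (by simp; linarith)

end Complement

/-! ### Regions correspond to sketches. -/

section SketchWord

variable {n : ℕ} {x y : Fin n → ℝ} {w : List Letter}

theorem mem_sketchWord {a : Letter} : a ∈ sketchWord x ↔ a ∈ alphabet n := by
  simp [sketchWord, List.mem_mergeSort]

theorem pairwise_sketchWord (hx : x ∈ complement n) :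
    (sketchWord x).Pairwise fun a b => value x a < value x b := by
  have h1 : (sketchWord x).Pairwise fun a b => value x a ≤ value x b := by
    have := List.pairwise_mergeSort (le := fun a b : Letter => decide (value x a ≤ value x b))
      (fun a b c => by simpa only [decide_eq_true_eq] using le_trans)
      (fun a b => by simpa only [Bool.or_eq_true, decide_eq_true_eq] using le_total _ _)
      (alphabet n).toList
    simpa [sketchWord] using this
  have h2 : (sketchWord x).Nodup :=
    (List.mergeSort_perm _ _).nodup_iff.2 (Finset.nodup_toList _)
  refine (h1.and h2).imp_of_mem fun ha hb h => lt_of_le_of_ne h.1 fun he => h.2 ?_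
  exact mem_complement_iff.1 hx _ (mem_sketchWord.1 ha) _ (mem_sketchWord.1 hb) he

theorem eq_sketchWord (hm : ∀ a, a ∈ w ↔ a ∈ alphabet n)
    (hw : w.Pairwise fun a b => value x a < value x b) (hx : x ∈ complement n) :
    w = sketchWord x := by
  have : Std.Irrefl fun a b : Letter => value x a < value x b := ⟨fun a => lt_irrefl _⟩
  have : Std.Antisymm fun a b : Letter => value x a < value x b :=
    ⟨fun a b h h' => (lt_asymm h h').elim⟩
  exact hw.eq_of_mem_iff (pairwise_sketchWord hx) fun a => by rw [hm, mem_sketchWord]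

theorem nodup_sketchWord (hx : x ∈ complement n) : (sketchWord x).Nodup :=
  (pairwise_sketchWord hx).imp fun h he => by simp [he] at h

theorem precedes_sketchWord_iff (hx : x ∈ complement n) {a b : Letter} (ha : a ∈ alphabet n)
    (hb : b ∈ alphabet n) : Precedes (sketchWord x) a b ↔ value x a < value x b := by
  have key : ∀ a b, Precedes (sketchWord x) a b → value x a < value x b := fun a b h =>
    List.pairwise_iff_forall_sublist.1 (pairwise_sketchWord hx) h
  refine ⟨key a b, fun h => ?_⟩
  rcases precedes_or_precedes (nodup_sketchWord hx) (mem_sketchWord.2 ha) (mem_sketchWord.2 hb)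
    (by rintro rfl; exact lt_irrefl _ h) with h' | h'
  · exact h'
  · exact (lt_asymm h (key _ _ h')).elim

theorem isSymmetricSketch_sketchWord (hx : x ∈ complement n) :
    IsSymmetricSketch n (sketchWord x) where
  length_eq := by
    rw [sketchWord, List.length_mergeSort, Finset.length_toList, card_alphabet]
  letters_eq := by
    ext a
    rw [List.mem_toFinset, mem_sketchWord]
  zero_before_one i hi := by
    rw [precedes_sketchWord_iff hx (mem_alphabet.2 hi) (mem_alphabet.2 hi)]
    simp [value]
  same_order i hi j hj := by
    rw [precedes_sketchWord_iff hx (mem_alphabet.2 hi) (mem_alphabet.2 hj),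
      precedes_sketchWord_iff hx (mem_alphabet.2 hi) (mem_alphabet.2 hj)]
    simp [value]
  symmetric i hi j hj s := by
    rw [precedes_sketchWord_iff hx (mem_alphabet.2 hi) (mem_alphabet.2 hj),
      precedes_sketchWord_iff hx (mem_alphabet.2 (neg_mem_labels hj))
        (mem_alphabet.2 (neg_mem_labels hi))]
    simp only [value, coord_neg]
    intro h
    simp only [Fin.val_zero, Nat.cast_zero] at *
    linarith

theorem continuous_value (a : Letter) : Continuous fun x : Fin n → ℝ => value x a :=
  (continuous_coord a.1).add continuous_const

theorem value_lineMap (t : ℝ) (a : Letter) :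
    value (AffineMap.lineMap x y t) a = AffineMap.lineMap (value x a) (value y a) t := by
  rw [value, coord_lineMap]
  simp only [value, AffineMap.lineMap_apply, vsub_eq_sub, vadd_eq_add, smul_eq_mul]
  ring

/-- If two values changed order on `S`, they would agree at some point of `S`, which the complement
forbids. -/
theorem sketchWord_eq_of_isPreconnected {S : Set (Fin n → ℝ)} (hS : IsPreconnected S)
    (hSc : S ⊆ complement n) (hx : x ∈ S) (hy : y ∈ S) : sketchWord x = sketchWord y := by
  refine eq_sketchWord (fun a => mem_sketchWord) ?_ (hSc hy)
  refine (pairwise_sketchWord (hSc hx)).imp_of_mem fun {a b} ha hb hab => ?_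
  by_contra hle
  rw [not_lt] at hle
  obtain ⟨z, hz, he⟩ := hS.intermediate_value₂ hx hy (continuous_value a).continuousOn
    (continuous_value b).continuousOn hab.le hle
  have := mem_complement_iff.1 (hSc hz) a (mem_sketchWord.1 ha) b (mem_sketchWord.1 hb) he
  subst this
  exact lt_irrefl _ hab

/-- Values are affine along the segment, so a strict order shared by the endpoints persists and the
segment stays in the complement. -/
theorem connectedComponentIn_eq_of_sketchWord_eq (hx : x ∈ complement n) (hy : y ∈ complement n)
    (h : sketchWord x = sketchWord y) :
    connectedComponentIn (complement n) x = connectedComponentIn (complement n) y := by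
  have hsub : segment ℝ x y ⊆ complement n := by
    rw [segment_eq_image_lineMap]
    rintro _ ⟨t, ht, rfl⟩
    rw [mem_complement_iff]
    have key : ∀ a b, Precedes (sketchWord x) a b →
        value (AffineMap.lineMap x y t) a < value (AffineMap.lineMap x y t) b := by
      intro a b hab
      have h1 : value x a < value x b :=
        List.pairwise_iff_forall_sublist.1 (pairwise_sketchWord hx) hab
      have h2 : value y a < value y b :=
        List.pairwise_iff_forall_sublist.1 (pairwise_sketchWord hy) (h ▸ hab)
      rw [value_lineMap, value_lineMap]
      simp only [AffineMap.lineMap_apply, vsub_eq_sub, vadd_eq_add, smul_eq_mul]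
      have h3 : 0 ≤ t := ht.1
      have h4 : t ≤ 1 := ht.2
      rcases h3.eq_or_lt with rfl | h3
      · simpa using h1
      · nlinarith [mul_pos h3 (sub_pos.2 h2), mul_nonneg (sub_nonneg.2 h4) (sub_pos.2 h1).le]
    intro a ha b hb he
    by_contra hab
    rcases precedes_or_precedes (nodup_sketchWord hx) (mem_sketchWord.2 ha)
      (mem_sketchWord.2 hb) hab with h' | h'
    · exact (key _ _ h').ne he
    · exact (key _ _ h').ne' he
  exact connectedComponentIn_eq
    ((convex_segment x y).isPreconnected.subset_connectedComponentIn
      (left_mem_segment ℝ x y) hsub (right_mem_segment ℝ x y))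

/-- A word that satisfies the order axioms of sketches lists the numbers `y i + s` in increasing
order, for suitable numbers `y i`. -/
theorem IsSymmetricSketch.exists_increasing (h : IsSymmetricSketch n w) :
    ∃ y : ℤ → ℝ, w.Pairwise fun a b => y a.1 + ((a.2 : ℕ) : ℝ) < y b.1 + ((b.2 : ℕ) : ℝ) := by
  -- Induction on prefixes. Call `j` open if `α_j^{(0)}` has been read but not `α_j^{(1)}`. The
  -- strengthening keeps the future value `y j + 1` of each open label above all values read so far.
  suffices H : ∀ u, u <+: w → ∃ y : ℤ → ℝ,
      (u.Pairwise fun a b => y a.1 + ((a.2 : ℕ) : ℝ) < y b.1 + ((b.2 : ℕ) : ℝ)) ∧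
      ∀ j, (j, 0) ∈ u → (j, 1) ∉ u → ∀ a ∈ u, y a.1 + ((a.2 : ℕ) : ℝ) < y j + 1 by
    obtain ⟨y, hy, -⟩ := H w List.prefix_rfl
    exact ⟨y, hy⟩
  intro u
  induction u using List.reverseRecOn with
  | nil => exact fun _ => ⟨0, by simp⟩
  | append_singleton u a ih =>
    intro hu
    obtain ⟨y, hy, hpend⟩ := ih ((List.prefix_append u [a]).trans hu)
    obtain ⟨v, rfl⟩ := hu
    have hnd := h.nodup
    have hndu : u.Nodup := hnd.sublist (by simp)
    have hsub : ∀ b c, Precedes u b c → Precedes (u ++ [a] ++ v) b c := fun b c hbc =>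
      List.Sublist.trans hbc (by simp)
    have hleft : ∀ b, Precedes (u ++ [a] ++ v) b a ↔ b ∈ u := fun b => by
      rw [List.append_assoc, List.singleton_append] at hnd ⊢
      exact precedes_append_cons_iff hnd
    have hau : a ∉ u := fun hau => ((hleft a).2 hau).ne hnd rfl
    have hlab : ∀ b ∈ u ++ [a], b.1 ∈ labels n := fun b hb =>
      (h.mem_iff b).1 (List.mem_append_left _ hb)
    obtain ⟨i, s⟩ := a
    have hi : i ∈ labels n := hlab (i, s) (by simp)
    fin_cases s
    · have hi1 : (i, 1) ∉ u := fun hi1 =>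
        ((hleft (i, 1)).2 hi1).asymm hnd (h.zero_before_one i hi)
      have hne : ∀ b ∈ u, b.1 ≠ i := by
        rintro ⟨j, t⟩ hb rfl
        fin_cases t
        · exact hau hb
        · exact hi1 hb
      -- The new value must exceed everything read and stay below `y j + 1` for each open `j`; the
      -- invariant leaves room.
      obtain ⟨c, hlo, hhi⟩ := Order.exists_between_finsets
        (u.toFinset.image fun b => y b.1 + ((b.2 : ℕ) : ℝ))
        ((u.toFinset.filter fun b => b.2 = 0 ∧ (b.1, 1) ∉ u).image fun b => y b.1 + 1) (by
          simp only [Finset.mem_image, List.mem_toFinset, Finset.mem_filter]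
          rintro _ ⟨b, hb, rfl⟩ _ ⟨⟨j, t⟩, ⟨hj, rfl, hj'⟩, rfl⟩
          exact hpend j hj hj' b hb)
      have hlo' : ∀ b ∈ u, y b.1 + ((b.2 : ℕ) : ℝ) < c := fun b hb =>
        hlo _ (Finset.mem_image_of_mem _ (List.mem_toFinset.2 hb))
      have hhi' : ∀ j, (j, 0) ∈ u → (j, 1) ∉ u → c < y j + 1 := fun j hj hj' =>
        hhi _ (Finset.mem_image.2 ⟨(j, 0), by simp [hj, hj'], rfl⟩)
      have hup : ∀ b ∈ u, Function.update y i c b.1 = y b.1 := fun b hb =>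
        Function.update_of_ne (hne b hb) _ _
      refine ⟨Function.update y i c, List.pairwise_append.2 ⟨?_, by simp, ?_⟩, ?_⟩
      · refine hy.imp_of_mem fun hb hb' hlt => ?_
        rwa [hup _ hb, hup _ hb']
      · intro b hb b' hb'
        rw [List.mem_singleton] at hb'
        subst hb'
        rw [hup _ hb]
        simpa using hlo' b hb
      · intro j hj hj'
        have hj'' : (j, 1) ∉ u := fun hj'' => hj' (List.mem_append_left _ hj'')
        rcases List.mem_append.1 hj with hj | hj
        · have hjy : Function.update y i c j = y j := hup _ hj
          intro b hb
          rw [hjy]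
          rcases List.mem_append.1 hb with hb | hb
          · rw [hup _ hb]
            exact hpend j hj hj'' b hb
          · rw [List.mem_singleton] at hb
            subst hb
            simpa using hhi' j hj hj''
        · have hji : j = i := by simpa using hj
          subst hji
          intro b hb
          rw [Function.update_self]
          rcases List.mem_append.1 hb with hb | hb
          · rw [hup _ hb]
            linarith [hlo' b hb]
          · rw [List.mem_singleton] at hb
            subst hb
            simp
    · have hi0 : (i, 0) ∈ u := (hleft (i, 0)).1 (h.zero_before_one i hi)
      refine ⟨y, List.pairwise_append.2 ⟨hy, by simp, ?_⟩, ?_⟩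
      · intro b hb b' hb'
        rw [List.mem_singleton] at hb'
        subst hb'
        simpa using hpend i hi0 hau b hb
      · intro j hj hj' b hb
        have hj0 : (j, 0) ∈ u := by simpa using hj
        have hj1 : (j, 1) ∉ u := fun hj'' => hj' (List.mem_append_left _ hj'')
        have hji : j ≠ i := by
          rintro rfl
          exact hj' (by simp)
        rcases List.mem_append.1 hb with hb | hb
        · exact hpend j hj0 hj1 b hb
        · rw [List.mem_singleton] at hb
          subst hb
          -- A label `j` opened before `i` would, by (iii), have been closed before `i`; so a still
          -- open `j` was opened later and `y i < y j`.
          rcases precedes_or_precedes hndu hi0 hj0 (by simpa using hji.symm) with hij | hij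
          · have := List.pairwise_iff_forall_sublist.1 hy hij
            simpa using this
          · exact (hj1 ((hleft (j, 1)).1
              (h.same_order j (hlab _ hj) i hi (hsub _ _ hij)))).elim

theorem exists_sketchWord_eq (h : IsSymmetricSketch n w) :
    ∃ x ∈ complement n, sketchWord x = w := by
  obtain ⟨y, hy⟩ := h.exists_increasing
  have hnd := h.nodup
  have hy' : ∀ a b, Precedes w a b → y a.1 + ((a.2 : ℕ) : ℝ) < y b.1 + ((b.2 : ℕ) : ℝ) :=
    fun a b hab => List.pairwise_iff_forall_sublist.1 hy hab
  -- The average of `y` and `i ↦ -y (-i)`; `key` says that the latter also realizes the word.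
  set x : Fin n → ℝ := fun k => (y (k + 1) - y (-(k + 1))) / 2 with hxdef
  have hx : ∀ i ∈ labels n, coord x i = (y i - y (-i)) / 2 := by
    intro i hi
    obtain ⟨k, rfl | rfl⟩ := exists_fin_of_mem_labels hi
    · rw [coord_of_fin]
    · rw [coord_neg, coord_of_fin, neg_neg]
      simp only [hxdef]
      ring
  have key : ∀ i ∈ labels n, ∀ j ∈ labels n, ∀ s t : Fin 2, Precedes w (i, s) (j, t) →
      y (-j) + ((s : ℕ) : ℝ) < y (-i) + ((t : ℕ) : ℝ) := by
    intro i hi j hj s t hp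
    have hi' := neg_mem_labels hi
    have hj' := neg_mem_labels hj
    fin_cases s
    · simpa using hy' _ _ (h.symmetric i hi j hj t hp)
    -- Condition (iv) only starts from a superscript 0. For `t = 0` its contrapositive is applied to
    -- `-i` and `-j`; for `t = 1`, (iii) reduces to the superscript 0 letters.
    · have hij : i ≠ j := by
        rintro rfl
        fin_cases t
        · exact hp.asymm hnd (h.zero_before_one i hi)
        · exact hp.ne hnd rfl
      have h0 : ∀ k ∈ labels n, ∀ s, (k, s) ∈ w := fun k hk s => (h.mem_iff _).2 hk
      fin_cases t
      · rcases precedes_or_precedes hnd (h0 _ hj' 1) (h0 _ hi' 0) (by simp) with hq | hq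
        · simpa using hy' _ _ hq
        · have := h.symmetric _ hi' _ hj' 1 hq
          rw [neg_neg, neg_neg] at this
          exact (hp.asymm hnd this).elim
      · rcases precedes_or_precedes hnd (h0 _ hi 0) (h0 _ hj 0) (by simpa using hij) with hq | hq
        · simpa using hy' _ _ (h.symmetric i hi j hj 0 hq)
        · exact (hp.asymm hnd (h.same_order j hj i hi hq)).elim
  have hw : w.Pairwise fun a b => value x a < value x b := by
    refine List.pairwise_iff_forall_sublist.2 fun {a b} hab => ?_
    have ha := (h.mem_iff a).1 (Precedes.mem_left hab)
    have hb := (h.mem_iff b).1 (Precedes.mem_right hab)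
    have h1 := key a.1 ha b.1 hb a.2 b.2 hab
    have h2 := hy' a b hab
    rw [value, value, hx _ ha, hx _ hb]
    linarith
  have hm : ∀ a, a ∈ w ↔ a ∈ alphabet n := fun a => by rw [h.mem_iff, mem_alphabet]
  have hxc : x ∈ complement n := by
    rw [mem_complement_iff]
    intro a ha b hb he
    by_contra hab
    rcases precedes_or_precedes hnd ((hm a).2 ha) ((hm b).2 hb) hab with hp | hp
    · exact (List.pairwise_iff_forall_sublist.1 hw hp).ne he
    · exact (List.pairwise_iff_forall_sublist.1 hw hp).ne' he
  exact ⟨x, hxc, (eq_sketchWord hm hw hxc).symm⟩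

end SketchWord

/-! ### Forests as roots plus a children function. -/

namespace Forest

section Basic

variable {α : Type} {f g : α → List α} {F G : Forest α} {a b : α} {k : ℕ}

/-- The labels in depth-first preorder. -/
def nodes : Forest α → List α
  | nil => []
  | cons a c r => a :: (c.nodes ++ r.nodes)

/-- Every node of the forest has the children that `f` assigns to its label. -/
def Compat (f : α → List α) : Forest α → Prop
  | nil => True
  | cons a c r => c.level 0 = f a ∧ c.Compat f ∧ r.Compat f

theorem length_nodes : F.nodes.length = F.size := by
  induction F with
  | nil => rfl
  | cons a c r hc hr =>
    simp only [nodes, size, List.length_cons, List.length_append, hc, hr]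
    omega

theorem eq_nil_of_level_zero (h : F.level 0 = []) : F = nil := by
  cases F with
  | nil => rfl
  | cons a c r => simp [level] at h

theorem Compat.eq (hF : F.Compat f) (hG : G.Compat f) (h : F.level 0 = G.level 0) : F = G := by
  induction F generalizing G with
  | nil => exact (eq_nil_of_level_zero h.symm).symm
  | cons a c r hc hr =>
    cases G with
    | nil => simp [level] at h
    | cons b c' r' =>
      simp only [level, List.cons.injEq] at h
      obtain ⟨rfl, h⟩ := h
      rw [hc hF.2.1 hG.2.1 (hF.1.trans hG.1.symm), hr hF.2.2 hG.2.2 h]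

theorem Compat.congr (hF : F.Compat f) (h : ∀ a ∈ F.nodes, f a = g a) : F.Compat g := by
  induction F with
  | nil => trivial
  | cons a c r hc hr =>
    simp only [nodes, List.mem_cons, List.mem_append] at h
    exact ⟨hF.1.trans (h a (Or.inl rfl)), hc hF.2.1 fun b hb => h b (Or.inr (Or.inl hb)),
      hr hF.2.2 fun b hb => h b (Or.inr (Or.inr hb))⟩

theorem Compat.apply_eq (hF : F.Compat f) (hG : F.Compat g) (ha : a ∈ F.nodes) : f a = g a := by
  induction F with
  | nil => simp [nodes] at ha
  | cons b c r hc hr =>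
    simp only [nodes, List.mem_cons, List.mem_append] at ha
    rcases ha with rfl | ha | ha
    · exact hF.1.symm.trans hG.1
    · exact hc hF.2.1 hG.2.1 ha
    · exact hr hF.2.2 hG.2.2 ha

/-- Distinct labels make the list of children a function of the label. -/
theorem exists_compat (h : F.nodes.Nodup) : ∃ f, F.Compat f := by
  classical
  induction F with
  | nil => exact ⟨fun _ => [], trivial⟩
  | cons a c r hc hr =>
    simp only [nodes, List.nodup_cons, List.mem_append, not_or, List.nodup_append] at h
    obtain ⟨fc, hfc⟩ := hc h.2.1
    obtain ⟨fr, hfr⟩ := hr h.2.2.1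
    refine ⟨fun p => if p = a then c.level 0 else if p ∈ c.nodes then fc p else fr p,
      by simp, hfc.congr fun p hp => ?_, hfr.congr fun p hp => ?_⟩
    · have : p ≠ a := by
        rintro rfl
        exact h.1.1 hp
      simp [this, hp]
    · have h1 : p ≠ a := by
        rintro rfl
        exact h.1.2 hp
      have h2 : p ∉ c.nodes := fun h2 => h.2.2.2 p h2 p hp rfl
      simp [h1, h2]

theorem Compat.level_succ (hF : F.Compat f) : F.level (k + 1) = (F.level k).flatMap f := by
  induction F generalizing k with
  | nil => cases k <;> rfl
  | cons a c r hc hr =>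
    cases k with
    | zero => simp only [level, List.flatMap_cons, hF.1, hr hF.2.2]
    | succ k => rw [level, level, List.flatMap_append, hc hF.2.1, hr hF.2.2]

theorem Compat.isChild_iff (hF : F.Compat f) : F.IsChild b a ↔ a ∈ F.nodes ∧ b ∈ f a := by
  induction F with
  | nil => simp [IsChild, nodes]
  | cons p c r hc hr =>
    simp only [IsChild, nodes, List.mem_cons, List.mem_append, hc hF.2.1, hr hF.2.2, hF.1]
    constructor
    · rintro (⟨rfl, h⟩ | h | h)
      · exact ⟨Or.inl rfl, h⟩
      · exact ⟨Or.inr (Or.inl h.1), h.2⟩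
      · exact ⟨Or.inr (Or.inr h.1), h.2⟩
    · rintro ⟨rfl | h | h, h'⟩
      · exact Or.inl ⟨rfl, h'⟩
      · exact Or.inr (Or.inl ⟨h, h'⟩)
      · exact Or.inr (Or.inr ⟨h, h'⟩)

theorem level_eq_nil (h : F.size ≤ k) : F.level k = [] := by
  induction F generalizing k with
  | nil => cases k <;> rfl
  | cons a c r hc hr =>
    simp only [size] at h
    obtain ⟨k, rfl⟩ : ∃ m, k = m + 1 := ⟨k - 1, by omega⟩
    rw [level, hc (by omega), hr (by omega), List.append_nil]

/-- The bound `k` is kept free because the subtrees and the remaining trees have smaller sizes;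
surplus levels are empty. -/
theorem flatMap_level_perm (h : F.size ≤ k) : ((List.range k).flatMap F.level).Perm F.nodes := by
  induction F generalizing k with
  | nil =>
    have : (nil : Forest α).level = fun _ => [] := by
      funext k
      cases k <;> rfl
    simp [nodes, this]
  | cons a c r hc hr =>
    simp only [size] at h
    obtain ⟨k, rfl⟩ : ∃ m, k = m + 1 := ⟨k - 1, by omega⟩
    have h1 := hc (k := k) (by omega)
    have h2 := hr (k := k + 1) (by omega)
    rw [List.range_succ_eq_map, List.flatMap_cons, List.flatMap_map] at h2 ⊢
    simp only [level, Nat.succ_eq_add_one, nodes, List.cons_append, List.perm_cons] at h2 ⊢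
    refine ((List.Perm.append_left _
      (List.flatMap_append_perm (List.range k) c.level fun m => r.level (m + 1)).symm).trans
        ?_).trans (h1.append h2)
    rw [← List.append_assoc, ← List.append_assoc]
    exact List.perm_append_comm.append_right _

theorem bfs_perm : F.bfs.Perm F.nodes := flatMap_level_perm le_rfl

theorem mem_bfs : a ∈ F.bfs ↔ a ∈ F.nodes := bfs_perm.mem_iff

theorem length_bfs : F.bfs.length = F.size := bfs_perm.length_eq.trans length_nodes

theorem Compat.flatMap_level_succ (hF : F.Compat f) :
    (List.range (k + 1)).flatMap F.level =
      F.level 0 ++ ((List.range k).flatMap F.level).flatMap f := by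
  rw [List.range_succ_eq_map, List.flatMap_cons, List.flatMap_map, List.flatMap_assoc]
  simp only [← hF.level_succ, Nat.succ_eq_add_one]

theorem Compat.bfs_eq (hF : F.Compat f) : F.bfs = F.level 0 ++ F.bfs.flatMap f := by
  rw [bfs, ← hF.flatMap_level_succ, List.range_succ, List.flatMap_append]
  simp [level_eq_nil le_rfl]

/-- Iterating `A ↦ F.level 0 ++ A.flatMap f` from the empty list produces the levels one at a time,
so the breadth-first order is the least list closed under this map. -/
theorem Compat.bfs_prefix (hF : F.Compat f) {A : List α} (hA : F.level 0 ++ A.flatMap f <+: A) :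
    F.bfs <+: A := by
  suffices H : ∀ k, (List.range k).flatMap F.level <+: A from H _
  intro k
  induction k with
  | zero => simp
  | succ k ih =>
    rw [hF.flatMap_level_succ]
    obtain ⟨B, rfl⟩ := ih
    refine List.IsPrefix.trans ?_ hA
    rw [List.flatMap_append, ← List.append_assoc]
    exact List.prefix_append _ _

end Basic

/-- The breadth-first order `L` of a forest with distinct labels, given by the list `R` of its
roots and the children `f a` of each node `a`. -/
structure IsBfsOrder {α : Type} (R L : List α) (f : α → List α) : Prop where
  nodup : L.Nodup
  eq_append : R ++ L.flatMap f = L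
  mem_of_eq : ∀ A a C, L = A ++ a :: C → a ∈ R ++ A.flatMap f

theorem Compat.isBfsOrder {α : Type} {f : α → List α} {F : Forest α} (hF : F.Compat f)
    (h : F.bfs.Nodup) : IsBfsOrder (F.level 0) F.bfs f where
  nodup := h
  eq_append := hF.bfs_eq.symm
  mem_of_eq A a C he := by
    have h1 : F.level 0 ++ A.flatMap f <+: F.bfs := by
      conv_rhs => rw [hF.bfs_eq]
      rw [he, List.flatMap_append, ← List.append_assoc]
      exact List.prefix_append _ _
    have h2 : A ++ [a] <+: F.bfs := ⟨C, by rw [he]; simp⟩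
    -- If `R ++ A.flatMap f` were a prefix of `A`, minimality would put the whole breadth-first
    -- order inside `A`, leaving no room for `a`.
    rcases List.prefix_or_prefix_of_prefix h2 h1 with h3 | h3
    · exact h3.subset (by simp)
    · rw [List.prefix_concat_iff] at h3
      rcases h3 with h3 | h3
      · rw [h3]
        simp
      · have h4 := (hF.bfs_prefix h3).length_le
        rw [he] at h4
        simp at h4

/-! ### Adding all children of a node at once. -/

section Attach

variable {α : Type} {f g : α → List α} {F : Forest α} {l : List α} {v i j : α}

/-- Put leaves with labels `l` in front of the forest `c`. -/
def leaves (l : List α) (c : Forest α) : Forest α := l.foldr (fun a r => cons a nil r) c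

theorem level_zero_leaves : (leaves l F).level 0 = l ++ F.level 0 := by
  induction l with
  | nil => rfl
  | cons a l ih =>
    simp only [leaves, List.foldr_cons, level, List.cons_append] at ih ⊢
    rw [ih]

theorem nodes_leaves : (leaves l F).nodes = l ++ F.nodes := by
  induction l with
  | nil => rfl
  | cons a l ih =>
    simp only [leaves, List.foldr_cons, nodes, List.cons_append, List.nil_append] at ih ⊢
    rw [ih]

theorem compat_leaves (h : ∀ a ∈ l, f a = []) (hF : F.Compat f) : (leaves l F).Compat f := by
  induction l with
  | nil => exact hF
  | cons a l ih =>
    exact ⟨(h a (by simp)).symm, trivial, ih fun b hb => h b (by simp [hb])⟩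

variable [DecidableEq α]

/-- Give the node `v` new leftmost children with labels `l`. -/
def attach (v : α) (l : List α) : Forest α → Forest α
  | nil => nil
  | cons a c r => if a = v then cons a (leaves l c) r else cons a (c.attach v l) (r.attach v l)

theorem insertSibling_leaves (hj : j ∉ l) :
    insertSibling j i (leaves (l ++ [j]) F) = leaves (l ++ [j, i]) F := by
  induction l with
  | nil => simp [leaves, insertSibling]
  | cons a l ih =>
    simp only [List.mem_cons, not_or] at hj
    have := ih hj.2
    simp only [leaves, List.cons_append, List.foldr_cons] at this ⊢
    rw [insertSibling, if_neg (Ne.symm hj.1), this]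
    rfl

theorem insertSibling_of_not_mem (hj : j ∉ F.nodes) : insertSibling j i F = F := by
  induction F with
  | nil => rfl
  | cons a c r hc hr =>
    simp only [nodes, List.mem_cons, List.mem_append, not_or] at hj
    rw [insertSibling, if_neg (Ne.symm hj.1), hc hj.2.1, hr hj.2.2]

theorem insertSibling_attach (hj : j ∉ F.nodes) (hl : j ∉ l) :
    insertSibling j i (attach v (l ++ [j]) F) = attach v (l ++ [j, i]) F := by
  induction F with
  | nil => rfl
  | cons a c r hc hr =>
    simp only [nodes, List.mem_cons, List.mem_append, not_or] at hj
    simp only [attach]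
    split_ifs
    · rw [insertSibling, if_neg (Ne.symm hj.1), insertSibling_leaves hl,
        insertSibling_of_not_mem hj.2.2]
    · rw [insertSibling, if_neg (Ne.symm hj.1), hc hj.2.1, hr hj.2.2]

theorem insertChild_eq_attach : insertChild v i F = attach v [i] F := by
  induction F with
  | nil => rfl
  | cons a c r hc hr => rw [insertChild, attach, hc, hr]; rfl

theorem attach_nil_right : attach v [] F = F := by
  induction F with
  | nil => rfl
  | cons a c r hc hr => rw [attach, hc, hr]; simp [leaves]

theorem attach_of_not_mem (hv : v ∉ F.nodes) : attach v l F = F := by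
  induction F with
  | nil => rfl
  | cons a c r hc hr =>
    simp only [nodes, List.mem_cons, List.mem_append, not_or] at hv
    rw [attach, if_neg (Ne.symm hv.1), hc hv.2.1, hr hv.2.2]

theorem level_zero_attach : (attach v l F).level 0 = F.level 0 := by
  induction F with
  | nil => rfl
  | cons a c r hc hr =>
    rw [attach]
    split_ifs
    · rfl
    · simp only [level, hr]

theorem nodes_attach_perm (h : F.nodes.Nodup) (hv : v ∈ F.nodes) :
    (attach v l F).nodes.Perm (F.nodes ++ l) := by
  induction F with
  | nil => simp [nodes] at hv
  | cons a c r hc hr =>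
    simp only [nodes, List.nodup_cons, List.mem_append, not_or, List.nodup_append,
      List.mem_cons] at h hv
    rw [attach]
    split_ifs with hav
    · simp only [nodes, nodes_leaves, List.cons_append, List.perm_cons]
      rw [List.append_assoc]
      exact List.perm_append_comm
    · simp only [nodes, List.cons_append, List.perm_cons]
      rcases hv with hv | hv | hv
      · exact (hav hv.symm).elim
      · rw [attach_of_not_mem (F := r) fun hv' => h.2.2.2 v hv v hv' rfl]
        refine ((hc h.2.1 hv).append_right _).trans ?_
        rw [List.append_assoc, List.append_assoc]
        exact List.perm_append_comm.append_left _
      · rw [attach_of_not_mem (F := c) fun hv' => h.2.2.2 v hv' v hv rfl, List.append_assoc]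
        exact (hr h.2.2.1 hv).append_left _

theorem Compat.attach (hF : F.Compat g) (h : F.nodes.Nodup) (hg : g v = [])
    (hfg : ∀ p ∈ F.nodes, p ≠ v → g p = f p) (hv : f v = l) (hl : ∀ b ∈ l, f b = []) :
    (attach v l F).Compat f := by
  induction F with
  | nil => trivial
  | cons a c r hc hr =>
    simp only [nodes, List.nodup_cons, List.mem_append, not_or, List.nodup_append,
      List.mem_cons] at h hfg
    rw [Forest.attach]
    split_ifs with hav
    · subst hav
      obtain rfl := eq_nil_of_level_zero (hF.1.trans hg)
      refine ⟨?_, compat_leaves hl trivial, hF.2.2.congr fun p hp => ?_⟩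
      · rw [level_zero_leaves, hv]
        simp [level]
      · exact hfg p (Or.inr (Or.inr hp)) (by rintro rfl; exact h.1.2 hp)
    · exact ⟨by rw [level_zero_attach, hF.1, hfg a (Or.inl rfl) hav],
        hc hF.2.1 h.2.1 fun p hp => hfg p (Or.inr (Or.inl hp)),
        hr hF.2.2 h.2.2.1 fun p hp => hfg p (Or.inr (Or.inr hp))⟩

end Attach

end Forest

/-! ### Words encoding forests. -/

section WordOf

open Forest

variable {R L A : List ℤ} {f : ℤ → List ℤ} {F : Forest ℤ} {i j v : ℤ}

/-- The letter `α_v^{(1)}` followed by the letters `α_i^{(0)}` for the children `i` of `v`. -/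
def block (f : ℤ → List ℤ) (v : ℤ) : List Letter := (v, 1) :: (f v).map fun i => (i, 0)

/-- The word of the forest with roots `R`, breadth-first order `L` and children `f`. -/
def wordOf (R L : List ℤ) (f : ℤ → List ℤ) : List Letter :=
  (R.map fun i => (i, 0)) ++ L.flatMap (block f)

/-- A block starts with a superscript 1 letter, which leaves the forest unchanged and replaces the
remembered letter. -/
theorem readWord_flatMap_block (p q : Option Letter) :
    readWord p F (L.flatMap (block f)) = readWord q F (L.flatMap (block f)) := by
  cases L with
  | nil => simp [readWord]
  | cons a L => simp [block, readWord]

theorem readWord_leaves (l l' : List ℤ) (h : (l ++ j :: l').Nodup) :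
    readWord (some (j, 0)) (leaves (l ++ [j]) nil)
      ((l'.map fun i => (i, 0)) ++ L.flatMap (block f)) =
    readWord none (leaves (l ++ j :: l') nil) (L.flatMap (block f)) := by
  induction l' generalizing l j with
  | nil => exact readWord_flatMap_block _ _
  | cons i l' ih =>
    have hj : j ∉ l := by
      simp only [List.nodup_append, List.mem_cons] at h
      exact fun hj => h.2.2 j hj j (Or.inl rfl) rfl
    have := ih (l ++ [j]) (j := i) (by simpa using h)
    simp only [List.map_cons, List.cons_append, readWord, insertSibling_leaves hj]
    simpa using this

theorem readWord_attach (l l' : List ℤ) (h : (l ++ j :: l').Nodup)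
    (hF : ∀ a ∈ l ++ j :: l', a ∉ F.nodes) :
    readWord (some (j, 0)) (attach v (l ++ [j]) F)
      ((l'.map fun i => (i, 0)) ++ L.flatMap (block f)) =
    readWord none (attach v (l ++ j :: l') F) (L.flatMap (block f)) := by
  induction l' generalizing l j with
  | nil => exact readWord_flatMap_block _ _
  | cons i l' ih =>
    have hj : j ∉ l := by
      simp only [List.nodup_append, List.mem_cons] at h
      exact fun hj => h.2.2 j hj j (Or.inl rfl) rfl
    have := ih (l ++ [j]) (j := i) (by simpa using h) (by simpa using hF)
    simp only [List.map_cons, List.cons_append, readWord,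
      insertSibling_attach (hF j (by simp)) hj]
    simpa using this

/-- The first child is inserted below `v` and each later one to the right of its predecessor, so the
block amounts to one `attach`. -/
theorem readWord_block (h : (f v).Nodup) (hF : ∀ a ∈ f v, a ∉ F.nodes) (p : Option Letter) :
    readWord p F (block f v ++ L.flatMap (block f)) =
      readWord none (attach v (f v) F) (L.flatMap (block f)) := by
  rw [block]
  cases hl : f v with
  | nil =>
    simp only [List.map_nil, List.cons_append, List.nil_append, readWord, attach_nil_right]
    exact readWord_flatMap_block _ _
  | cons i l =>
    rw [hl] at h hF
    simp only [List.map_cons, List.cons_append, readWord, insertChild_eq_attach]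
    exact readWord_attach [] l h hF

theorem forestOfWord_wordOf_eq (h : R.Nodup) :
    forestOfWord (wordOf R L f) = readWord none (leaves R nil) (L.flatMap (block f)) := by
  cases R with
  | nil => rfl
  | cons i l => exact readWord_leaves [] l h

/-- Invariant after the blocks of `A`: the nodes are the roots and the children of `A`, and nodes
outside `A` are still leaves. The next `v` is already present by `mem_of_eq`, and its children are
new because `L` has no repetition. -/
theorem Forest.IsBfsOrder.exists_forestOfWord_eq (h : IsBfsOrder R L f) (A B : List ℤ)
    (hL : L = A ++ B) : ∃ F : Forest ℤ, F.nodes.Perm (R ++ A.flatMap f) ∧ F.level 0 = R ∧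
      F.Compat (fun p => if p ∈ A then f p else []) ∧
      forestOfWord (wordOf R L f) = readWord none F (B.flatMap (block f)) := by
  have hnd := h.nodup
  rw [← h.eq_append] at hnd
  induction A using List.reverseRecOn generalizing B with
  | nil =>
    refine ⟨leaves R nil, ?_, ?_, compat_leaves (by simp) trivial, ?_⟩
    · simp [nodes_leaves, nodes]
    · simp [level_zero_leaves, level]
    · rw [forestOfWord_wordOf_eq hnd.of_append_left, hL]
      rfl
  | append_singleton A v ih =>
    obtain ⟨F, hp, h0, hc, he⟩ := ih (v :: B) (by simpa using hL)
    have hL' : L = A ++ v :: B := by simpa using hL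
    have hvL : (A ++ v :: B).Nodup := hL' ▸ h.nodup
    have hnd' : ((R ++ A.flatMap f) ++ f v).Nodup := by
      refine hnd.sublist ?_
      rw [hL', List.append_assoc]
      simp
    have hdisj : ∀ a ∈ f v, a ∉ R ++ A.flatMap f := fun a ha ha' =>
      (List.nodup_append.1 hnd').2.2 a ha' a ha rfl
    have hv : v ∈ R ++ A.flatMap f := h.mem_of_eq A v B hL'
    have hvA : v ∉ A := fun hvA => by
      simp only [List.nodup_append, List.mem_cons] at hvL
      exact hvL.2.2 v hvA v (Or.inl rfl) rfl
    have hA : ∀ a ∈ A, a ∈ R ++ A.flatMap f := by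
      intro a ha
      obtain ⟨A₁, A₂, rfl⟩ := List.append_of_mem ha
      have := h.mem_of_eq A₁ a (A₂ ++ v :: B) (by simpa using hL')
      rw [List.flatMap_append, ← List.append_assoc]
      exact List.mem_append_left _ this
    have hFnd : F.nodes.Nodup := hp.nodup_iff.2 hnd'.of_append_left
    refine ⟨attach v (f v) F, ?_, level_zero_attach.trans h0, ?_, ?_⟩
    · refine (nodes_attach_perm hFnd (hp.mem_iff.2 hv)).trans ?_
      simpa using hp.append_right (f v)
    · refine hc.attach hFnd (by simp [hvA]) (fun p _ hpv => by simp [hpv]) (by simp) ?_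
      intro b hb
      have h1 : b ∉ A := fun h1 => hdisj b hb (hA b h1)
      have h2 : b ≠ v := by
        rintro rfl
        exact hdisj b hb hv
      simp [h1, h2]
    · rw [he, List.flatMap_cons]
      exact readWord_block hnd'.of_append_right (fun a ha ha' => hdisj a ha (hp.mem_iff.1 ha')) _

theorem Forest.IsBfsOrder.forestOfWord_spec (h : IsBfsOrder R L f) :
    (forestOfWord (wordOf R L f)).Compat f ∧ (forestOfWord (wordOf R L f)).level 0 = R ∧
      (forestOfWord (wordOf R L f)).bfs = L := by
  obtain ⟨F, hp, h0, hc, he⟩ := h.exists_forestOfWord_eq L [] (by simp)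
  rw [he]
  simp only [List.flatMap_nil, readWord]
  rw [h.eq_append] at hp
  have hc' : F.Compat f := hc.congr fun a ha => by simp [hp.mem_iff.1 ha]
  refine ⟨hc', h0, (hc'.bfs_prefix ?_).eq_of_length (bfs_perm.trans hp).length_eq⟩
  rw [h0, h.eq_append]

theorem filter_wordOf_zero :
    (wordOf R L f).filter (fun a => a.2 = 0) = (R ++ L.flatMap f).map fun i => (i, 0) := by
  have hz : ∀ l : List ℤ, (l.map fun i => ((i, 0) : Letter)).filter (fun a => a.2 = 0) =
      l.map fun i => (i, 0) := fun l => List.filter_eq_self.2 (by simp)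
  rw [wordOf, List.filter_append, hz, List.map_append, List.filter_flatMap, List.map_flatMap]
  congr 1
  refine congrArg (fun g => List.flatMap g L) (funext fun v => ?_)
  rw [block, List.filter_cons_of_neg (by simp), hz]

theorem filter_wordOf_one :
    (wordOf R L f).filter (fun a => a.2 = 1) = L.map fun i => (i, 1) := by
  have hz : ∀ l : List ℤ, (l.map fun i => ((i, 0) : Letter)).filter (fun a => a.2 = 1) = [] :=
    fun l => List.filter_eq_nil_iff.2 (by simp)
  rw [wordOf, List.filter_append, hz, List.filter_flatMap, List.nil_append,
    List.map_eq_flatMap]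
  refine congrArg (fun g => List.flatMap g L) (funext fun v => ?_)
  rw [block, List.filter_cons_of_pos (by simp), hz]

theorem mem_wordOf_zero : (i, 0) ∈ wordOf R L f ↔ i ∈ R ++ L.flatMap f := by
  simp [wordOf, block]

theorem mem_wordOf_one : (i, 1) ∈ wordOf R L f ↔ i ∈ L := by
  simp [wordOf, block]

theorem precedes_wordOf_zero_iff :
    Precedes (wordOf R L f) (i, 0) (j, 0) ↔ Precedes (R ++ L.flatMap f) i j := by
  rw [← precedes_filter_iff (p := fun a => a.2 = 0) (by simp) (by simp), filter_wordOf_zero]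
  exact precedes_map_iff (f := fun i : ℤ => ((i, 0) : Letter)) fun a b h => congrArg Prod.fst h

theorem precedes_wordOf_one_iff :
    Precedes (wordOf R L f) (i, 1) (j, 1) ↔ Precedes L i j := by
  rw [← precedes_filter_iff (p := fun a => a.2 = 1) (by simp) (by simp), filter_wordOf_one]
  exact precedes_map_iff (f := fun i : ℤ => ((i, 1) : Letter)) fun a b h => congrArg Prod.fst h

theorem nodup_wordOf_iff : (wordOf R L f).Nodup ↔ (R ++ L.flatMap f).Nodup ∧ L.Nodup := by
  have h0 : Function.Injective fun i : ℤ => ((i, 0) : Letter) := fun a b h => congrArg Prod.fst h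
  have h1 : Function.Injective fun i : ℤ => ((i, 1) : Letter) := fun a b h => congrArg Prod.fst h
  constructor
  · intro h
    refine ⟨(List.nodup_map_iff h0).1 ?_, (List.nodup_map_iff h1).1 ?_⟩
    · rw [← filter_wordOf_zero]
      exact h.filter _
    · rw [← filter_wordOf_one]
      exact h.filter _
  · rintro ⟨hz, ho⟩
    refine (List.filter_append_perm (fun a : Letter => decide (a.2 = 0)) _).nodup_iff.1 ?_
    have : (fun a : Letter => !decide (a.2 = 0)) = fun a => decide (a.2 = 1) := by
      funext ⟨i, s⟩
      fin_cases s <;> rfl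
    rw [this, filter_wordOf_zero, filter_wordOf_one, List.nodup_append]
    refine ⟨(List.nodup_map_iff h0).2 hz, (List.nodup_map_iff h1).2 ho, ?_⟩
    simp

/-- Before `α_j^{(1)}` the word contains only the roots and the blocks of `A`. -/
theorem precedes_wordOf_zero_one_iff {C : List ℤ} (h : (wordOf R (A ++ j :: C) f).Nodup) :
    Precedes (wordOf R (A ++ j :: C) f) (i, 0) (j, 1) ↔ i ∈ R ++ A.flatMap f := by
  have he : wordOf R (A ++ j :: C) f =
      wordOf R A f ++ (j, 1) :: (((f j).map fun i => (i, 0)) ++ C.flatMap (block f)) := by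
    simp [wordOf, block]
  rw [he] at h ⊢
  rw [precedes_append_cons_iff h, mem_wordOf_zero]

theorem exists_blocks (w : List Letter) : ∃ (R : List ℤ) (P : List (ℤ × List ℤ)),
    w = (R.map fun i => (i, 0)) ++ P.flatMap fun p => (p.1, 1) :: p.2.map fun i => (i, 0) := by
  induction w with
  | nil => exact ⟨[], [], rfl⟩
  | cons a w ih =>
    obtain ⟨R, P, rfl⟩ := ih
    obtain ⟨i, s⟩ := a
    fin_cases s
    · exact ⟨i :: R, P, rfl⟩
    · exact ⟨[], (i, R) :: P, rfl⟩

theorem exists_wordOf {w : List Letter} (h : w.Nodup) : ∃ R L f, w = wordOf R L f := by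
  obtain ⟨R, P, rfl⟩ := exists_blocks w
  have hP : (P.map Prod.fst).Nodup := by
    have hs : (P.map fun p => ((p.1, 1) : Letter)).Sublist
        (P.flatMap fun p => ((p.1, 1) : Letter) :: p.2.map fun i => (i, 0)) := by
      clear h
      induction P with
      | nil => simp
      | cons p P ih =>
        rw [List.map_cons, List.flatMap_cons, List.cons_append]
        exact (ih.trans (List.sublist_append_right _ _)).cons_cons _
    have := h.of_append_right.sublist hs
    refine List.Nodup.of_map (fun i : ℤ => ((i, 1) : Letter)) ?_
    rwa [List.map_map]
  classical
  let f : ℤ → List ℤ := fun v => if h : ∃ l, (v, l) ∈ P then h.choose else []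
  have hf : ∀ p ∈ P, f p.1 = p.2 := by
    intro p hp
    have hex : ∃ l, (p.1, l) ∈ P := ⟨p.2, hp⟩
    have : f p.1 = hex.choose := dif_pos hex
    rw [this]
    exact congrArg Prod.snd (List.inj_on_of_nodup_map hP hex.choose_spec hp rfl)
  refine ⟨R, P.map Prod.fst, f, ?_⟩
  rw [wordOf, List.flatMap_map]
  congr 1
  refine List.flatMap_congr fun p hp => ?_
  rw [block, hf p hp]

/-- Condition (iii) equates the label orders of the two superscripts, which gives `eq_append`;
condition (ii) gives `mem_of_eq`. -/
theorem IsSymmetricSketch.exists_eq_wordOf {n : ℕ} {w : List Letter} (h : IsSymmetricSketch n w) :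
    ∃ R L f, IsBfsOrder R L f ∧ w = wordOf R L f := by
  have hw := h.nodup
  obtain ⟨R, L, f, rfl⟩ := exists_wordOf hw
  have hL := (nodup_wordOf_iff.1 hw).2
  refine ⟨R, L, f, ⟨hL, ?_, ?_⟩, rfl⟩
  · have h0 : ∀ i, i ∈ R ++ L.flatMap f ↔ i ∈ labels n := fun i => by
      rw [← mem_wordOf_zero, h.mem_iff]
    have h1 : ∀ i, i ∈ L ↔ i ∈ labels n := fun i => by
      rw [← mem_wordOf_one (R := R) (f := f), h.mem_iff]
    refine eq_of_precedes_imp hL (fun i => by rw [h0, h1]) fun i j hij => ?_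
    have := h.same_order i ((h0 i).1 hij.mem_left) j ((h0 j).1 hij.mem_right)
      (precedes_wordOf_zero_iff.2 hij)
    exact precedes_wordOf_one_iff.1 this
  · rintro A a C rfl
    rw [← precedes_wordOf_zero_one_iff hw]
    exact h.zero_before_one a ((h.mem_iff (a, 1)).1 (mem_wordOf_one.2 (by simp)))

theorem Forest.IsBfsOrder.nodup_wordOf (h : IsBfsOrder R L f) : (wordOf R L f).Nodup :=
  nodup_wordOf_iff.2 ⟨h.eq_append.symm ▸ h.nodup, h.nodup⟩

theorem Forest.IsBfsOrder.precedes_wordOf_iff (h : IsBfsOrder R L f) :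
    Precedes (wordOf R L f) (i, 0) (j, 0) ↔ Precedes L i j := by
  rw [precedes_wordOf_zero_iff, h.eq_append]

theorem Forest.IsBfsOrder.precedes_wordOf_self (h : IsBfsOrder R L f) (hi : i ∈ L) :
    Precedes (wordOf R L f) (i, 0) (i, 1) := by
  obtain ⟨A, C, rfl⟩ := List.append_of_mem hi
  rw [precedes_wordOf_zero_one_iff h.nodup_wordOf]
  exact h.mem_of_eq A i C rfl

theorem Forest.IsBfsOrder.isSubDescendant_iff (h : IsBfsOrder R L f) (hF : F.Compat f)
    (hL : F.bfs = L) (hi : i ∈ L) (hj : j ∈ L) :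
    F.IsSubDescendant i j ↔ Precedes L j i ∧ Precedes (wordOf R L f) (i, 0) (j, 1) := by
  rw [IsSubDescendant, hL]
  refine and_congr_right fun hji => ?_
  obtain ⟨A, C, rfl⟩ := List.append_of_mem hj
  have hnd := h.nodup
  -- The second part consists of the children of `j` and of later nodes; preceding all of them means
  -- lying in the first part.
  have he : (R ++ A.flatMap f) ++ (j :: C).flatMap f = A ++ j :: C := by
    rw [List.append_assoc, ← List.flatMap_append, h.eq_append]
  rw [precedes_wordOf_zero_one_iff h.nodup_wordOf]
  constructor
  · intro hk
    rw [← he, List.mem_append] at hi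
    refine hi.resolve_right fun hi => ?_
    obtain ⟨k, hkC, hik⟩ := List.mem_flatMap.1 hi
    have hjk : k = j ∨ Precedes (A ++ j :: C) j k := by
      rcases List.mem_cons.1 hkC with rfl | hkC
      · exact Or.inl rfl
      · exact Or.inr (((List.singleton_sublist.2 hkC).cons_cons j).trans
          (List.sublist_append_right _ _))
    have hkF : k ∈ F.nodes := by
      rw [← mem_bfs, hL]
      exact List.mem_append_right _ hkC
    exact (hk k i hjk (hF.isChild_iff.2 ⟨hkF, hik⟩)).ne hnd rfl
  · intro hiA k c hk hc
    rw [hF.isChild_iff, ← mem_bfs, hL] at hc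
    have hkC : k ∈ j :: C := by
      rcases hk with rfl | hk
      · simp
      · refine (List.mem_append.1 hc.1).resolve_left fun hkA => ?_
        exact hk.asymm hnd ((precedes_append_cons_iff hnd).2 hkA)
    rw [← he]
    exact (List.singleton_sublist.2 hiA).append
      (List.singleton_sublist.2 (List.mem_flatMap.2 ⟨k, hkC, hc.2⟩))

end WordOf

/-! ### Symmetric sketches correspond to symmetric forests. -/

section Symmetric

open Forest

variable {n : ℕ} {R L : List ℤ} {f : ℤ → List ℤ} {F : Forest ℤ} {i j : ℤ}

theorem mem_labels_iff_abs : i ∈ labels n ↔ 1 ≤ |i| ∧ |i| ≤ n := by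
  rw [mem_labels]
  rcases abs_cases i with h | h <;> omega

theorem precedes_neg_reverse_iff :
    Precedes (L.map fun e => -e).reverse i j ↔ Precedes L (-j) (-i) := by
  rw [precedes_reverse_iff, ← precedes_map_iff (l := L) (f := fun e : ℤ => -e) neg_injective,
    neg_neg, neg_neg]

theorem IsSymmetricSketch.isSymmetricForest (h : IsBfsOrder R L f) (hF : F.Compat f)
    (hL : F.bfs = L) (hw : IsSymmetricSketch n (wordOf R L f)) : IsSymmetricForest n F := by
  have hmem : ∀ i, i ∈ L ↔ i ∈ labels n := fun i => by
    rw [← mem_wordOf_one (R := R) (f := f), hw.mem_iff]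
  have hlen : L.length = 2 * n := by
    rw [← List.toFinset_card_of_nodup h.nodup, ← card_labels]
    congr
    ext i
    rw [List.mem_toFinset, hmem]
  have hsymm : ∀ i j, Precedes L i j → Precedes L (-j) (-i) := fun i j hij =>
    h.precedes_wordOf_iff.1 (hw.symmetric i ((hmem i).1 hij.mem_left) j
      ((hmem j).1 hij.mem_right) 0 (h.precedes_wordOf_iff.2 hij))
  -- Case `s = 0` of (iv), in list form.
  have hrev : L = (L.map fun e => -e).reverse := by
    refine eq_of_precedes_imp ?_ (fun i => ?_) fun i j hij => ?_
    · exact List.nodup_reverse.2 ((List.nodup_map_iff neg_injective).2 h.nodup)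
    · simp only [List.mem_reverse, List.mem_map, hmem]
      exact ⟨fun hi => ⟨-i, neg_mem_labels hi, neg_neg i⟩, by
        rintro ⟨k, hk, rfl⟩
        exact neg_mem_labels hk⟩
    · exact precedes_neg_reverse_iff.2 (hsymm i j hij)
  have hlast : L.drop n = ((L.take n).map fun e => -e).reverse := by
    nth_rewrite 1 [hrev]
    rw [List.drop_reverse, List.length_map, hlen, ← List.map_take]
    congr 4
    omega
  refine ⟨by rw [← length_bfs, hL, hlen], ?_, by rw [hL, hlast], ?_⟩
  · rw [hL]
    ext k
    simp only [List.mem_toFinset, List.mem_map, Finset.mem_Icc]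
    constructor
    · rintro ⟨e, he, rfl⟩
      exact mem_labels_iff_abs.1 ((hmem e).1 (List.mem_of_mem_take he))
    · intro hk
      have hkL : k ∈ L := (hmem k).2 (by rw [mem_labels]; omega)
      rw [← List.take_append_drop n L, List.mem_append, hlast] at hkL
      rcases hkL with hkL | hkL
      · exact ⟨k, hkL, abs_of_nonneg (by omega)⟩
      · simp only [List.mem_reverse, List.mem_map] at hkL
        obtain ⟨e, he, rfl⟩ := hkL
        exact ⟨e, he, by rw [abs_of_nonpos (by omega)]⟩
  · intro i hi j hj hij
    rw [hL] at hi hj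
    have hi' := (hmem i).1 hi
    have hj' := (hmem j).1 hj
    rw [h.isSubDescendant_iff hF hL hi hj] at hij
    rw [h.isSubDescendant_iff hF hL ((hmem _).2 (neg_mem_labels hj'))
      ((hmem _).2 (neg_mem_labels hi'))]
    exact ⟨hsymm _ _ hij.1, hw.symmetric i hi' j hj' 1 hij.2⟩

theorem IsSymmetricForest.bfs_eq (hF : IsSymmetricForest n F) :
    F.bfs = F.bfs.take n ++ ((F.bfs.take n).map fun e => -e).reverse := by
  nth_rewrite 1 [← List.take_append_drop n F.bfs]
  rw [hF.last_half]

theorem IsSymmetricForest.mem_bfs_iff (hF : IsSymmetricForest n F) :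
    i ∈ F.bfs ↔ i ∈ labels n := by
  have hT : ∀ k : ℤ, (∃ e ∈ F.bfs.take n, |e| = k) ↔ 1 ≤ k ∧ k ≤ n := fun k => by
    rw [← Finset.mem_Icc, ← hF.first_half]
    simp only [List.mem_toFinset, List.mem_map]
  rw [hF.bfs_eq, mem_labels_iff_abs]
  simp only [List.mem_append, List.mem_reverse, List.mem_map]
  constructor
  · rintro (hi | ⟨i, hi, rfl⟩)
    · exact (hT |i|).1 ⟨i, hi, rfl⟩
    · rw [abs_neg]
      exact (hT |i|).1 ⟨i, hi, rfl⟩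
  · intro hi
    obtain ⟨e, he, hei⟩ := (hT |i|).2 hi
    rcases abs_eq_abs.1 hei with rfl | rfl
    · exact Or.inl he
    · exact Or.inr ⟨-i, he, neg_neg i⟩

theorem IsSymmetricForest.nodup_bfs (hF : IsSymmetricForest n F) : F.bfs.Nodup := by
  rw [← Multiset.coe_nodup, ← Multiset.toFinset_card_eq_card_iff_nodup]
  change F.bfs.toFinset.card = F.bfs.length
  rw [length_bfs, hF.size_eq, ← card_labels]
  congr
  ext i
  rw [List.mem_toFinset, hF.mem_bfs_iff]

theorem IsSymmetricForest.isSymmetricSketch (hF : IsSymmetricForest n F) (hf : F.Compat f)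
    (h : IsBfsOrder R F.bfs f) : IsSymmetricSketch n (wordOf R F.bfs f) := by
  have hletters : (wordOf R F.bfs f).toFinset = alphabet n := by
    ext ⟨i, s⟩
    rw [List.mem_toFinset, mem_alphabet, ← hF.mem_bfs_iff]
    fin_cases s
    · exact mem_wordOf_zero.trans (by rw [h.eq_append])
    · exact mem_wordOf_one
  have hrev : F.bfs = (F.bfs.map fun e => -e).reverse := by
    rw [hF.bfs_eq]
    simp
  have hsymm : ∀ i j, Precedes F.bfs i j → Precedes F.bfs (-j) (-i) := fun i j hij => by
    rw [hrev] at hij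
    exact precedes_neg_reverse_iff.1 hij
  have hnd := h.nodup_wordOf
  refine ⟨?_, hletters, ?_, ?_, ?_⟩
  · rw [← List.toFinset_card_of_nodup hnd, hletters, card_alphabet]
  · exact fun i hi => h.precedes_wordOf_self (hF.mem_bfs_iff.2 hi)
  · intro i _ j _
    rw [h.precedes_wordOf_iff, precedes_wordOf_one_iff]
    exact id
  · intro i hi j hj s
    have hi' := hF.mem_bfs_iff.2 (neg_mem_labels hi)
    have hj' := hF.mem_bfs_iff.2 (neg_mem_labels hj)
    rw [← hF.mem_bfs_iff] at hi hj
    fin_cases s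
    · intro hij
      exact h.precedes_wordOf_iff.2 (hsymm i j (h.precedes_wordOf_iff.1 hij))
    · intro hij
      by_cases he : i = j
      · subst he
        exact h.precedes_wordOf_self hi'
      -- If `i` is before `j`, the reversal symmetry and (ii) suffice; only when `j` is before `i`
      -- does sub-descendance carry information.
      · rcases precedes_or_precedes h.nodup hi hj he with hp | hp
        · exact (h.precedes_wordOf_iff.2 (hsymm i j hp)).trans hnd (h.precedes_wordOf_self hi')
        · have := hF.subDescendant i hi j hj ((h.isSubDescendant_iff hf rfl hi hj).2 ⟨hp, hij⟩)
          exact ((h.isSubDescendant_iff hf rfl hj' hi').1 this).2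

theorem IsSymmetricSketch.isSymmetricForest_forestOfWord {w : List Letter}
    (hw : IsSymmetricSketch n w) : IsSymmetricForest n (forestOfWord w) := by
  obtain ⟨R, L, f, h, rfl⟩ := hw.exists_eq_wordOf
  exact hw.isSymmetricForest h h.forestOfWord_spec.1 h.forestOfWord_spec.2.2

/-- The roots, breadth-first order and children lists can be read off the forest, and they rebuild
the word. -/
theorem forestOfWord_injOn : Set.InjOn forestOfWord (sketches n) := by
  intro w hw w' hw' he
  obtain ⟨R, L, f, h, rfl⟩ := IsSymmetricSketch.exists_eq_wordOf hw
  obtain ⟨R', L', f', h', rfl⟩ := IsSymmetricSketch.exists_eq_wordOf hw'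
  obtain ⟨hc, hR, hL⟩ := h.forestOfWord_spec
  obtain ⟨hc', hR', hL'⟩ := h'.forestOfWord_spec
  rw [← he] at hc' hR' hL'
  rw [wordOf, wordOf, ← hR, ← hR', ← hL, ← hL']
  congr 1
  refine List.flatMap_congr fun v hv => ?_
  rw [block, block, hc.apply_eq hc' (mem_bfs.1 hv)]

theorem IsSymmetricForest.exists_forestOfWord_eq (hF : IsSymmetricForest n F) :
    ∃ w, IsSymmetricSketch n w ∧ forestOfWord w = F := by
  obtain ⟨f, hf⟩ := exists_compat (bfs_perm.nodup_iff.1 hF.nodup_bfs)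
  have h := hf.isBfsOrder hF.nodup_bfs
  have hs := h.forestOfWord_spec
  exact ⟨_, hF.isSymmetricSketch hf h, hs.1.eq hf hs.2.1⟩

end Symmetric

end TypeCCatalan

/-! ### Assembly of the two bijections. -/

theorem mainTheorem4 (n : ℕ) :
    ∃ (σ : TypeCCatalan.regions n → TypeCCatalan.sketches n)
      (φ : TypeCCatalan.sketches n → TypeCCatalan.symmetricForests n),
      (∀ R : TypeCCatalan.regions n, ∀ x ∈ (R : Set (Fin n → ℝ)),
        (σ R : List TypeCCatalan.Letter) = TypeCCatalan.sketchWord x) ∧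
      (∀ w : TypeCCatalan.sketches n,
        (φ w : TypeCCatalan.Forest ℤ) =
          TypeCCatalan.forestOfWord (w : List TypeCCatalan.Letter)) ∧
      Function.Bijective (φ ∘ σ) := by
  have hbase : ∀ R : TypeCCatalan.regions n, ∃ x ∈ TypeCCatalan.complement n,
      (R : Set (Fin n → ℝ)) = connectedComponentIn (TypeCCatalan.complement n) x :=
    fun R => R.2
  -- `σ` is defined through a chosen base point of each region; `hσ` shows that the choice is
  -- immaterial.
  choose p hp hR using hbase
  let σ : TypeCCatalan.regions n → TypeCCatalan.sketches n := fun R =>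
    ⟨TypeCCatalan.sketchWord (p R), TypeCCatalan.isSymmetricSketch_sketchWord (hp R)⟩
  let φ : TypeCCatalan.sketches n → TypeCCatalan.symmetricForests n := fun w =>
    ⟨TypeCCatalan.forestOfWord w,
      TypeCCatalan.IsSymmetricSketch.isSymmetricForest_forestOfWord w.2⟩
  have hσ : ∀ R : TypeCCatalan.regions n, ∀ x ∈ (R : Set (Fin n → ℝ)),
      (σ R : List TypeCCatalan.Letter) = TypeCCatalan.sketchWord x := by
    intro R x hx
    rw [hR R] at hx
    exact TypeCCatalan.sketchWord_eq_of_isPreconnected isPreconnected_connectedComponentIn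
      (connectedComponentIn_subset _ _) (mem_connectedComponentIn (hp R)) hx
  refine ⟨σ, φ, hσ, fun w => rfl, Function.Bijective.comp ⟨?_, ?_⟩ ⟨?_, ?_⟩⟩
  · intro w w' h
    exact Subtype.ext (TypeCCatalan.forestOfWord_injOn w.2 w'.2 (congrArg Subtype.val h))
  · rintro ⟨F, hF⟩
    obtain ⟨w, hw, rfl⟩ := TypeCCatalan.IsSymmetricForest.exists_forestOfWord_eq hF
    exact ⟨⟨w, hw⟩, rfl⟩
  · intro R R' h
    refine Subtype.ext ?_
    rw [hR R, hR R']
    exact TypeCCatalan.connectedComponentIn_eq_of_sketchWord_eq (hp R) (hp R')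
      (congrArg Subtype.val h)
  · rintro ⟨w, hw⟩
    obtain ⟨x, hx, rfl⟩ := TypeCCatalan.exists_sketchWord_eq hw
    exact ⟨⟨_, x, hx, rfl⟩, Subtype.ext (hσ _ x (mem_connectedComponentIn hx))⟩
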